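/- Let $E$ be a real reflexive Banach space with separable dual, let $t_0\le T$, and let $(\Omega,\mathcal F,\{\mathcal F_t\}_{t\in[t_0,T]},\mathbb P)$ be a filtered probability space satisfying the usual conditions ($\mathcal F$ is complete, the filtration is right-continuous, and every $\mathcal F_t$ contains all $\mathbb P$-null sets). A set-valued map $X$ is called measurable with respect to a $\sigma$-algebra if $\{X\cap O\neq\emptyset\}$ belongs to it for every open $O\subseteq E$. Let $B=\{B_t\}_{t\in[t_0,T]}$ be a process whose values are non-empty closed subsets of $E$, such that $B_t$ is $\mathcal F_t$-measurable for every $t$ and $B_s\subseteq B_t$ for all $s<t$. Let $G=\{G_t\}_{t\in[t_0,T]}$ be a process whose values are closed convex subsets of $E$ containing $0$ and contained in one fixed closed bounded set $K\subseteq E$ (for all $\omega$ and $t$), such that $(\omega,t)\mapsto G_t(\omega)$ is measurable with respect to the predictable $\sigma$-algebra, which is generated by the sets $A\times\{t_0\}$ with $A\in\mathcal F_{t_0}$ and $A\times(s,t]$ with $A\in\mathcal F_s$, $(s,t]\subseteq[t_0,T]$. Write $A\oplus C=\overline{\{a+c:a\in A,\ c\in C\}}$ (so $\emptyset\oplus C=\emptyset$),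 and let $\int_a^b G(\tau)\,d\tau$ be the pathwise Aumann integral, i.e. the set of all Bochner integrals $\int_a^b g(\tau)\,d\tau$ of Lebesgue-integrable $g:[t_0,T]\to E$ with $g(\tau)\in G_\tau$ for a.e. $\tau$. For $t\in[t_0,T]$ and a partition $\Pi=\{t_0<t_1<\dots<t_n=t\}$ of $[t_0,t]$ put $\Delta B_{t_i}=B_{t_i}\setminus \operatorname{int}B_{t_{i-1}}$ and $$s_\Pi(t)=\Big(B_{t_0}\oplus\int_{t_0}^tG(\tau)\,d\tau\Big)\cup\bigcup_{i=1}^n\Big(\Delta B_{t_i}\oplus\int_{t_i}^tG(\tau)\,d\tau\Big),$$ $$S_\Pi(t)=\Big(B_{t_0}\oplus\int_{t_0}^tG(\tau)\,d\tau\Big)\cup\bigcup_{i=1}^n\Big(\Delta B_{t_i}\oplus\int_{t_{i-1}}^tG(\tau)\,d\tau\Big).$$ For every $t\in[t_0,T]$ let $\{\Pi^t_j\}_{j\in\mathbb N}$ be a sequence of partitions of $[t_0,t]$ whose mesh tends to $0$. A geometric random process (G-RaP) is a process $\Theta=\{\Theta_t\}_{t\in[t_0,T]}$ with non-empty closed values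 such that, almost surely, for all $t\in[t_0,T]$, $$\Theta_t=\overline{\bigcup_{j}s_{\Pi^t_j}(t)}=\lim_{j\to\infty}s_{\Pi^t_j}(t)=\lim_{j\to\infty}S_{\Pi^t_j}(t)=\bigcap_jS_{\Pi^t_j}(t),$$ where the limits are taken in the Hausdorff distance. Then a G-RaP exists, and every G-RaP $\Theta$ is non-decreasing with respect to set inclusion, that is, $$\mathbb P\big(\Theta_s\subseteq\Theta_t\ \text{ for all } t_0\le s<t\le T\big)=1,$$ and $\Theta$ is adapted to $\{\mathcal F_t\}_{t\in[t_0,T]}$, that is, $\Theta_t$ is $\mathcal F_t$-measurable for every $t\in[t_0,T]$. -/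

import Mathlib

open MeasureTheory Filter Topology
open scoped Pointwise ENNReal

namespace BirthGrowth

/-- A set-valued map `X` on `(Ω, m)` is measurable if it hits every open set on an event. -/
def SetMeasurable {Ω E : Type*} [TopologicalSpace E] (m : MeasurableSpace Ω)
    (X : Ω → Set E) : Prop :=
  ∀ O : Set E, IsOpen O → MeasurableSet[m] {ω | (X ω ∩ O).Nonempty}

/-- Measurable maps on `(Ω, m)` whose values are non-empty closed subsets of `E`. -/
structure IsRandomClosedSet {Ω E : Type*} [TopologicalSpace E] (m : MeasurableSpace Ω)
    (X : Ω → Set E) : Prop where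
  nonempty : ∀ ω, (X ω).Nonempty
  closed : ∀ ω, IsClosed (X ω)
  measurable : SetMeasurable m X

/-- `A ⊕ C`, the closure of the Minkowski sum. -/
def closedSum {E : Type*} [TopologicalSpace E] [Add E] (A C : Set E) : Set E :=
  closure (A + C)

/-- The integrable (a.e.) selections of a set-valued map. -/
def selections {α E : Type*} [MeasurableSpace α] [NormedAddCommGroup E]
    (X : α → Set E) (μ : Measure α) : Set (α → E) :=
  {x | Integrable x μ ∧ ∀ᵐ a ∂μ, x a ∈ X a}

/-- The Aumann integral of `X` over `A`: all Bochner integrals over `A` of integrable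
selections of `X`. -/
noncomputable def aumannIntegral {α E : Type*} [MeasurableSpace α] [NormedAddCommGroup E]
    [NormedSpace ℝ E] (X : α → Set E) (μ : Measure α) (A : Set α) : Set E :=
  {y | ∃ x ∈ selections X μ, y = ∫ a in A, x a ∂μ}

/-- Reflexivity of a normed space: the canonical map into the bidual is onto. -/
def IsReflexiveSpace (E : Type*) [NormedAddCommGroup E] [NormedSpace ℝ E] : Prop :=
  Function.Surjective (NormedSpace.inclusionInDoubleDual ℝ E)

/-- The usual conditions: right-continuity, and every subset of a null event belongs to every
`𝓕 t` (here `P A` is the outer measure of an arbitrary set `A`; in particular the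
probability space is complete). -/
structure UsualConditions {Ω ι : Type*} [PartialOrder ι] {m : MeasurableSpace Ω}
    (𝓕 : Filtration ι m) (P : Measure Ω) : Prop where
  rightContinuous : 𝓕.IsRightContinuous
  complete : ∀ (t : ι) (A : Set Ω), P A = 0 → MeasurableSet[𝓕 t] A

section Processes

variable {t₀ T : ℝ} {Ω E : Type*} {m : MeasurableSpace Ω}

/-- A nucleation process: adapted, with non-empty closed values, increasing in time. -/
structure IsNucleationProcess [TopologicalSpace E] (𝓕 : Filtration (Set.Icc t₀ T) m)
    (B : Set.Icc t₀ T → Ω → Set E) : Prop where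
  adapted : ∀ t, IsRandomClosedSet (𝓕 t) (B t)
  increasing : ∀ s t, s < t → ∀ ω, B s ω ⊆ B t ω

/-- A growth process: a predictable process of closed convex sets that contain the origin and
lie in one bounded closed set. -/
structure IsGrowthProcess [Fact (t₀ ≤ T)] [NormedAddCommGroup E] [NormedSpace ℝ E]
    (𝓕 : Filtration (Set.Icc t₀ T) m) (G : Set.Icc t₀ T → Ω → Set E) : Prop where
  closed : ∀ t ω, IsClosed (G t ω)
  zero_mem : ∀ t ω, (0 : E) ∈ G t ω
  convex : ∀ t ω, Convex ℝ (G t ω)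
  bounded : ∃ K : Set E, K.Nonempty ∧ IsClosed K ∧ Bornology.IsBounded K ∧ ∀ t ω, G t ω ⊆ K
  predictable : SetMeasurable 𝓕.predictable (fun p : Set.Icc t₀ T × Ω => G p.1 p.2)

/-- A partition `t₀ = pts 0 < pts 1 < ⋯ < pts n = t` of `[t₀, t]`, where `t ∈ [t₀, T]`. For
`t = t₀` it is the single point `t₀`, with `n = 0`. -/
structure TimePartition [Fact (t₀ ≤ T)] (t : Set.Icc t₀ T) where
  n : ℕ
  pts : Fin (n + 1) → Set.Icc t₀ T
  strictMono : StrictMono pts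
  first : pts 0 = ⊥
  last : pts (Fin.last n) = t

/-- The largest length of an interval of the partition (`0` if there is none). -/
noncomputable def TimePartition.mesh [Fact (t₀ ≤ T)] {t : Set.Icc t₀ T}
    (Q : TimePartition t) : ℝ :=
  ⨆ i : Fin Q.n, ((Q.pts i.succ : ℝ) - (Q.pts i.castSucc : ℝ))

/-- A sequence of partitions of `[t₀, t]` whose mesh tends to `0`. -/
def IsRefinementSequence [Fact (t₀ ≤ T)] {t : Set.Icc t₀ T} (Q : ℕ → TimePartition t) : Prop :=
  Tendsto (fun j => (Q j).mesh) atTop (𝓝 0)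

variable [Fact (t₀ ≤ T)] [NormedAddCommGroup E] [NormedSpace ℝ E]

/-- `∫_a^b G(ω, τ) dτ`, the Aumann integral for Lebesgue measure on `[t₀, T]`. -/
noncomputable def growthIntegral (G : Set.Icc t₀ T → Ω → Set E) (a b : Set.Icc t₀ T)
    (ω : Ω) : Set E :=
  aumannIntegral (fun τ => G τ ω) (Measure.comap Subtype.val volume) (Set.Icc a b)

/-- The nucleation increment `B_t ∖ interior B_s`. -/
def increment (B : Set.Icc t₀ T → Ω → Set E) (s t : Set.Icc t₀ T) (ω : Ω) : Set E :=
  B t ω \ interior (B s ω)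

/-- The lower sum of a partition of `[t₀, t]`. -/
noncomputable def lowerSum (B G : Set.Icc t₀ T → Ω → Set E) {t : Set.Icc t₀ T}
    (Q : TimePartition t) (ω : Ω) : Set E :=
  closedSum (B ⊥ ω) (growthIntegral G ⊥ t ω) ∪
    ⋃ i : Fin Q.n, closedSum (increment B (Q.pts i.castSucc) (Q.pts i.succ) ω)
      (growthIntegral G (Q.pts i.succ) t ω)

/-- The upper sum of a partition of `[t₀, t]`. -/
noncomputable def upperSum (B G : Set.Icc t₀ T → Ω → Set E) {t : Set.Icc t₀ T}
    (Q : TimePartition t) (ω : Ω) : Set E :=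
  closedSum (B ⊥ ω) (growthIntegral G ⊥ t ω) ∪
    ⋃ i : Fin Q.n, closedSum (increment B (Q.pts i.castSucc) (Q.pts i.succ) ω)
      (growthIntegral G (Q.pts i.castSucc) t ω)

/-- `A` is the common limit of the lower and upper sums of the partitions `Q 0, Q 1, …` at `ω`:
it is the closure of the union of the lower sums, the Hausdorff limit of the lower sums, the
Hausdorff limit of the upper sums, and the intersection of the upper sums. -/
structure IsCommonLimit (B G : Set.Icc t₀ T → Ω → Set E) {t : Set.Icc t₀ T}
    (Q : ℕ → TimePartition t) (ω : Ω) (A : Set E) : Prop where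
  closure_iUnion_lower : A = closure (⋃ j, lowerSum B G (Q j) ω)
  tendsto_lower :
    Tendsto (fun j => Metric.hausdorffEDist (lowerSum B G (Q j) ω) A) atTop (𝓝 0)
  tendsto_upper :
    Tendsto (fun j => Metric.hausdorffEDist (upperSum B G (Q j) ω) A) atTop (𝓝 0)
  iInter_upper : A = ⋂ j, upperSum B G (Q j) ω

/-- `Θ` is a geometric random process with nucleation `B` and growth `G`, formed along the
sequences of partitions `Q t` of `[t₀, t]`: a process with non-empty closed values such that,
almost surely, every `Θ t` is the common limit of the lower and upper sums. -/
structure IsGeometricRandomProcess (P : Measure Ω) (B G : Set.Icc t₀ T → Ω → Set E)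
    (Q : ∀ t : Set.Icc t₀ T, ℕ → TimePartition t) (Θ : Set.Icc t₀ T → Ω → Set E) : Prop where
  nonempty : ∀ t ω, (Θ t ω).Nonempty
  closed : ∀ t ω, IsClosed (Θ t ω)
  limit : ∀ᵐ ω ∂P, ∀ t, IsCommonLimit B G (Q t) ω (Θ t ω)

end Processes

end BirthGrowth

/-! Fix ω. A point born by time r and grown over [r, t] lies in every upper sum at t: trace it back
to the first partition point t_i whose nucleus contains it. If i > 0 then t_{i-1} ≤ r, and 0 ∈ G
lets the integral expand to [t_{i-1}, t]. Hence every lower sum at s ≤ t lies in every upper sum at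
t (`lowerSum_subset_upperSum`). Conversely, the two sums of one partition start the growth of an
increment at most a mesh apart, so when G is bounded by M they are within M · mesh
(`infEDist_lowerSum_le`). The closed union of the lower sums is squeezed between them, which gives
existence; the comparison for s < t gives monotonicity.

For adaptedness the increments are eliminated: Θ_t is a.s. the closure of a countable union of sets
B_r + ∫_r^t G over partition points r (`closure_iUnion_lowerSum_eq`). Castaing representations of
B_r and of the Aumann integral make each of these measurable at time t
(`setMeasurable_add_growthIntegral`), and completeness of the filtration absorbs the null set. -/

namespace BirthGrowth

/-! ### Pathwise comparison of lower and upper sums. -/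

section Pathwise

variable {t₀ T : ℝ} {Ω E : Type*}

instance isFiniteMeasure_comap_Icc :
    IsFiniteMeasure (Measure.comap (Subtype.val : Set.Icc t₀ T → ℝ) volume) :=
  ⟨by
    rw [(MeasurableEmbedding.subtype_coe measurableSet_Icc).comap_apply]
    exact (measure_mono (Subtype.coe_image_subset _ _)).trans_lt (measure_Icc_lt_top (a := t₀) (b := T))⟩

lemma comap_Icc_Ico_le (a b : Set.Icc t₀ T) :
    Measure.comap (Subtype.val : Set.Icc t₀ T → ℝ) volume (Set.Ico a b) ≤
      ENNReal.ofReal ((b : ℝ) - a) := by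
  rw [(MeasurableEmbedding.subtype_coe measurableSet_Icc).comap_apply, ← Real.volume_Ico]
  refine measure_mono ?_
  rintro _ ⟨x, hx, rfl⟩
  exact ⟨hx.1, hx.2⟩

variable [NormedAddCommGroup E] [NormedSpace ℝ E]
  {B G : Set.Icc t₀ T → Ω → Set E} {ω : Ω}

lemma zero_mem_growthIntegral (h0 : ∀ τ, (0 : E) ∈ G τ ω) (a b : Set.Icc t₀ T) :
    (0 : E) ∈ growthIntegral G a b ω :=
  ⟨fun _ => 0, ⟨integrable_zero _ _ _, ae_of_all _ h0⟩, by simp⟩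

/-- Selections vanishing outside `Icc a b` show that the integral grows with the interval. -/
lemma growthIntegral_mono (h0 : ∀ τ, (0 : E) ∈ G τ ω) {a a' b b' : Set.Icc t₀ T}
    (ha : a' ≤ a) (hb : b ≤ b') : growthIntegral G a b ω ⊆ growthIntegral G a' b' ω := by
  rintro _ ⟨x, ⟨hx, hxG⟩, rfl⟩
  refine ⟨(Set.Icc a b).indicator x, ⟨hx.indicator measurableSet_Icc, ?_⟩, ?_⟩
  · filter_upwards [hxG] with τ hτ
    by_cases h : τ ∈ Set.Icc a b
    · simpa [h] using hτ
    · simpa [h] using h0 τ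
  · rw [setIntegral_indicator measurableSet_Icc,
      Set.inter_eq_right.2 (Set.Icc_subset_Icc ha hb)]

/-- Shortening the interval by `a' - a` moves the integral by at most `M * (a' - a)`. -/
lemma exists_mem_growthIntegral_edist_le {M : ℝ} (hM0 : 0 ≤ M)
    (hM : ∀ τ, ∀ y ∈ G τ ω, ‖y‖ ≤ M)
    {a a' b : Set.Icc t₀ T} (ha : a ≤ a') {y : E} (hy : y ∈ growthIntegral G a b ω) :
    ∃ y' ∈ growthIntegral G a' b ω, edist y y' ≤ ENNReal.ofReal (M * ((a' : ℝ) - a)) := by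
  obtain ⟨x, ⟨hx, hxG⟩, rfl⟩ := hy
  -- The selection is kept; only its integral over a subset of [a, a') is lost.
  refine ⟨_, ⟨x, ⟨hx, hxG⟩, rfl⟩, ?_⟩
  set μ := Measure.comap (Subtype.val : Set.Icc t₀ T → ℝ) volume with hμ
  have hsub : Set.Icc a b \ Set.Icc a' b ⊆ Set.Ico a a' := by
    rintro τ ⟨h1, h2⟩
    exact ⟨h1.1, lt_of_not_ge fun h => h2 ⟨h, h1.2⟩⟩
  have hle : (a : ℝ) ≤ a' := ha
  have hr : μ.real (Set.Icc a b \ Set.Icc a' b) ≤ (a' : ℝ) - a := by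
    refine ENNReal.toReal_le_of_le_ofReal (by linarith) ?_
    exact (measure_mono hsub).trans (comap_Icc_Ico_le a a')
  rw [edist_dist, dist_eq_norm]
  refine ENNReal.ofReal_le_ofReal ?_
  rw [← setIntegral_sdiff measurableSet_Icc hx.integrableOn (Set.Icc_subset_Icc_left ha)]
  have hxM : ∀ᵐ τ ∂μ.restrict (Set.Icc a b \ Set.Icc a' b), ‖x τ‖ ≤ M :=
    ae_restrict_of_ae (hxG.mono fun τ hτ => hM τ _ hτ)
  exact (norm_setIntegral_le_of_norm_le_const_ae (measure_lt_top _ _) hxM).trans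
    (mul_le_mul_of_nonneg_left hr hM0)

variable [Fact (t₀ ≤ T)]

lemma isClosed_upperSum {t : Set.Icc t₀ T} (Q : TimePartition t) :
    IsClosed (upperSum B G Q ω) :=
  isClosed_closure.union (isClosed_iUnion_of_finite fun _ => isClosed_closure)

/-- Whatever is born at time `r` and grows during `[r, s]` is contained in every upper sum at a
later time. -/
lemma add_growthIntegral_subset_upperSum (hB : Monotone fun τ => B τ ω)
    (h0 : ∀ τ, (0 : E) ∈ G τ ω) {r s t : Set.Icc t₀ T} (hr : r ≤ t) (hs : s ≤ t)
    (Q : TimePartition t) : B r ω + growthIntegral G r s ω ⊆ upperSum B G Q ω := by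
  rintro _ ⟨x, hx, y, hy, rfl⟩
  have key : ∀ k, x ∈ B (Q.pts k) ω → x + y ∈ upperSum B G Q ω := by
    intro k
    induction k using Fin.induction with
    | zero =>
      intro hk
      rw [Q.first] at hk
      exact Or.inl (subset_closure (Set.add_mem_add hk (growthIntegral_mono h0 bot_le hs hy)))
    | succ i ih =>
      intro hk
      by_cases hi : x ∈ B (Q.pts i.castSucc) ω
      · exact ih hi
      -- Here x is new in this increment. It is already in B at time r, so r cannot precede the left
      -- endpoint.
      · have hlt : Q.pts i.castSucc ≤ r := le_of_not_ge fun h => hi (hB h hx)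
        refine Or.inr (Set.mem_iUnion.2 ⟨i, subset_closure (Set.add_mem_add ?_ ?_)⟩)
        · exact ⟨hk, fun h => hi (interior_subset h)⟩
        · exact growthIntegral_mono h0 hlt hs hy
  refine key (Fin.last _) ?_
  rw [Q.last]
  exact hB hr hx

lemma TimePartition.pts_le {t : Set.Icc t₀ T} (Q : TimePartition t) (k : Fin (Q.n + 1)) :
    Q.pts k ≤ t :=
  (Q.strictMono.monotone (Fin.le_last k)).trans_eq Q.last

lemma TimePartition.sub_le_mesh {t : Set.Icc t₀ T} (Q : TimePartition t) (i : Fin Q.n) :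
    (Q.pts i.succ : ℝ) - Q.pts i.castSucc ≤ Q.mesh :=
  le_ciSup (f := fun i : Fin Q.n => (Q.pts i.succ : ℝ) - Q.pts i.castSucc)
    (Set.finite_range _).bddAbove i

lemma lowerSum_subset_iUnion {t : Set.Icc t₀ T} (Q : TimePartition t) :
    lowerSum B G Q ω ⊆ ⋃ k, closure (B (Q.pts k) ω + growthIntegral G (Q.pts k) t ω) := by
  refine Set.union_subset ?_ (Set.iUnion_subset fun i => ?_)
  · refine Set.subset_iUnion_of_subset 0 ?_
    rw [Q.first]
    exact subset_rfl
  · exact Set.subset_iUnion_of_subset i.succ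
      (closure_mono (Set.add_subset_add_right Set.sdiff_subset))

/-- The partitions are unrelated and the times may differ, so this serves both the squeeze at one
time and monotonicity in time. -/
lemma lowerSum_subset_upperSum (hB : Monotone fun τ => B τ ω) (h0 : ∀ τ, (0 : E) ∈ G τ ω)
    {s t : Set.Icc t₀ T} (hst : s ≤ t) (Q : TimePartition s) (Q' : TimePartition t) :
    lowerSum B G Q ω ⊆ upperSum B G Q' ω :=
  (lowerSum_subset_iUnion Q).trans <| Set.iUnion_subset fun k =>
    closure_minimal (add_growthIntegral_subset_upperSum hB h0 ((Q.pts_le k).trans hst) hst Q')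
      (isClosed_upperSum Q')

/-- Keep the birth point and delay its growth from the left to the right endpoint of its interval;
the cost is at most M times the interval length. -/
lemma infEDist_lowerSum_le {M : ℝ} (hM0 : 0 ≤ M) (hM : ∀ τ, ∀ y ∈ G τ ω, ‖y‖ ≤ M)
    {t : Set.Icc t₀ T} (Q : TimePartition t) {x : E} (hx : x ∈ upperSum B G Q ω) :
    Metric.infEDist x (lowerSum B G Q ω) ≤ ENNReal.ofReal (M * Q.mesh) := by
  rcases hx with hx | hx
  · have hx' : x ∈ lowerSum B G Q ω := Or.inl hx
    rw [Metric.infEDist_zero_of_mem hx']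
    exact zero_le
  · obtain ⟨i, hi⟩ := Set.mem_iUnion.1 hx
    have hcl : IsClosed {z : E | Metric.infEDist z (lowerSum B G Q ω) ≤
        ENNReal.ofReal (M * Q.mesh)} :=
      isClosed_Iic.preimage Metric.continuous_infEDist
    refine closure_minimal ?_ hcl hi
    rintro _ ⟨b, hb, y, hy, rfl⟩
    obtain ⟨y', hy', hd⟩ := exists_mem_growthIntegral_edist_le hM0 hM
      (Q.strictMono.monotone i.castSucc_lt_succ.le) hy
    have hmem : b + y' ∈ lowerSum B G Q ω :=
      Or.inr (Set.mem_iUnion.2 ⟨i, subset_closure (Set.add_mem_add hb hy')⟩)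
    refine (Metric.infEDist_le_edist_of_mem hmem).trans ?_
    change edist (b + y) (b + y') ≤ _
    rw [edist_add_left]
    exact hd.trans (ENNReal.ofReal_le_ofReal
      (mul_le_mul_of_nonneg_left (Q.sub_le_mesh i) hM0))

lemma closure_iUnion_lowerSum_subset_upperSum (hB : Monotone fun τ => B τ ω)
    (h0 : ∀ τ, (0 : E) ∈ G τ ω) {s t : Set.Icc t₀ T} (hst : s ≤ t) (Q : ℕ → TimePartition s)
    (Q' : TimePartition t) :
    closure (⋃ j, lowerSum B G (Q j) ω) ⊆ upperSum B G Q' ω :=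
  closure_minimal (Set.iUnion_subset fun j => lowerSum_subset_upperSum hB h0 hst (Q j) Q')
    (isClosed_upperSum Q')

theorem isCommonLimit_closure_iUnion_lowerSum (hB : Monotone fun τ => B τ ω)
    (h0 : ∀ τ, (0 : E) ∈ G τ ω) {M : ℝ} (hM0 : 0 ≤ M) (hM : ∀ τ, ∀ y ∈ G τ ω, ‖y‖ ≤ M)
    {t : Set.Icc t₀ T} {Q : ℕ → TimePartition t} (hQ : IsRefinementSequence Q) :
    IsCommonLimit B G Q ω (closure (⋃ j, lowerSum B G (Q j) ω)) := by
  set A := closure (⋃ j, lowerSum B G (Q j) ω) with hA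
  have hlow : ∀ j, lowerSum B G (Q j) ω ⊆ A := fun j =>
    (Set.subset_iUnion (fun j => lowerSum B G (Q j) ω) j).trans subset_closure
  have hup : ∀ j, A ⊆ upperSum B G (Q j) ω := fun j =>
    closure_iUnion_lowerSum_subset_upperSum hB h0 le_rfl Q (Q j)
  have hlim : Tendsto (fun j => ENNReal.ofReal (M * (Q j).mesh)) atTop (𝓝 0) := by
    have h := ENNReal.tendsto_ofReal ((show Tendsto _ _ _ from hQ).const_mul M)
    simpa using h
  refine ⟨rfl, ?_, ?_, ?_⟩
  · refine tendsto_of_tendsto_of_tendsto_of_le_of_le tendsto_const_nhds hlim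
      (fun _ => zero_le) fun j => ?_
    refine Metric.hausdorffEDist_le_of_infEDist (fun x hx => ?_) (fun x hx => ?_)
    · rw [Metric.infEDist_zero_of_mem (hlow j hx)]
      exact zero_le
    · exact infEDist_lowerSum_le hM0 hM (Q j) (hup j hx)
  · refine tendsto_of_tendsto_of_tendsto_of_le_of_le tendsto_const_nhds hlim
      (fun _ => zero_le) fun j => ?_
    refine Metric.hausdorffEDist_le_of_infEDist (fun x hx => ?_) (fun x hx => ?_)
    · exact (Metric.infEDist_anti (hlow j)).trans (infEDist_lowerSum_le hM0 hM (Q j) hx)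
    · rw [Metric.infEDist_zero_of_mem (hup j hx)]
      exact zero_le
  · refine Set.Subset.antisymm (Set.subset_iInter hup) fun x hx => ?_
    rw [Metric.mem_iff_infEDist_zero_of_closed (s := A) isClosed_closure]
    refine le_antisymm (ge_of_tendsto' hlim fun j => ?_) zero_le
    exact (Metric.infEDist_anti (hlow j)).trans
      (infEDist_lowerSum_le hM0 hM (Q j) (Set.mem_iInter.1 hx j))

/-- The limit of the lower sums, written without increments. -/
lemma closure_iUnion_lowerSum_eq (hB : Monotone fun τ => B τ ω) (h0 : ∀ τ, (0 : E) ∈ G τ ω)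
    {t : Set.Icc t₀ T} {Q : ℕ → TimePartition t}
    (hlim : closure (⋃ j, lowerSum B G (Q j) ω) = ⋂ j, upperSum B G (Q j) ω) :
    closure (⋃ j, lowerSum B G (Q j) ω) =
      closure (⋃ (j) (k), B ((Q j).pts k) ω + growthIntegral G ((Q j).pts k) t ω) := by
  refine Set.Subset.antisymm ?_ ?_
  · refine closure_minimal (Set.iUnion_subset fun j => ?_) isClosed_closure
    refine (lowerSum_subset_iUnion (Q j)).trans (Set.iUnion_subset fun k => closure_mono ?_)
    exact Set.subset_iUnion₂ (s := fun j k =>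
      B ((Q j).pts k) ω + growthIntegral G ((Q j).pts k) t ω) j k
  · refine closure_minimal (Set.iUnion₂_subset fun j k => ?_) isClosed_closure
    rw [hlim]
    exact Set.subset_iInter fun i =>
      add_growthIntegral_subset_upperSum hB h0 ((Q j).pts_le k) le_rfl (Q i)

end Pathwise

/-! ### Measurable selections and Castaing representations. -/

section Selections

variable {α E : Type*} {mα : MeasurableSpace α} [MetricSpace E]
  [TopologicalSpace.SeparableSpace E] [MeasurableSpace E] [BorelSpace E] {X : α → Set E}

/-- The distance is a Carathéodory function, continuous in the point and measurable in the
parameter, hence jointly measurable on separable E. -/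
lemma IsRandomClosedSet.measurable_infDist (hX : IsRandomClosedSet mα X) {h : α → E}
    (hh : Measurable h) : Measurable fun p => Metric.infDist (h p) (X p) := by
  have hpt : ∀ x, Measurable fun p => Metric.infDist x (X p) := by
    refine fun x => measurable_of_Iio fun r => ?_
    have hset : (fun p => Metric.infDist x (X p)) ⁻¹' Set.Iio r =
        {p | (X p ∩ Metric.ball x r).Nonempty} := by
      ext p
      refine (Metric.infDist_lt_iff (hX.nonempty p)).trans ⟨?_, ?_⟩
      · rintro ⟨y, hy, hyd⟩
        exact ⟨y, hy, Metric.mem_ball'.2 hyd⟩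
      · rintro ⟨y, hy, hyd⟩
        exact ⟨y, hy, Metric.mem_ball'.1 hyd⟩
    rw [hset]
    exact hX.measurable _ Metric.isOpen_ball
  have hun : Measurable fun q : E × α => Metric.infDist q.1 (X q.2) :=
    measurable_uncurry_of_continuous_of_measurable
      (u := fun x p => Metric.infDist x (X p)) (fun p => Metric.continuous_infDist_pt (X p)) hpt
  have hpair : Measurable fun p => (h p, p) := hh.prodMk measurable_id
  have hcomp := hun.fun_comp hpair
  exact hcomp

/-- Both conditions are open, so some term of a dense sequence meets them; taking the first such
index is measurable. -/
lemma IsRandomClosedSet.exists_measurable_approx (hX : IsRandomClosedSet mα X) {h : α → E}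
    (hh : Measurable h) {δ : ℝ} (hδ : 0 < δ) :
    ∃ f : α → E, Measurable f ∧ (∀ p, dist (f p) (h p) < Metric.infDist (h p) (X p) + δ) ∧
      ∀ p, Metric.infDist (f p) (X p) < δ := by
  classical
  rcases isEmpty_or_nonempty α with hα | ⟨⟨p₀⟩⟩
  · exact ⟨h, hh, fun p => hα.elim p, fun p => hα.elim p⟩
  have : Nonempty E := (hX.nonempty p₀).to_type
  let c := TopologicalSpace.denseSeq E
  let A : α → ℕ → Prop := fun p n =>
    dist (c n) (h p) < Metric.infDist (h p) (X p) + δ ∧ Metric.infDist (c n) (X p) < δ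
  have hA : ∀ p, ∃ n, A p n := by
    intro p
    obtain ⟨y, hy, hyd⟩ := (Metric.infDist_lt_iff (hX.nonempty p)).1
      (lt_add_of_pos_right (Metric.infDist (h p) (X p)) hδ)
    have hopen : IsOpen {z : E | dist z (h p) < Metric.infDist (h p) (X p) + δ ∧
        Metric.infDist z (X p) < δ} :=
      (isOpen_lt (continuous_id.dist continuous_const) continuous_const).inter
        (isOpen_lt (Metric.continuous_infDist_pt _) continuous_const)
    obtain ⟨n, hn⟩ := (TopologicalSpace.denseRange_denseSeq E).exists_mem_open hopen
      ⟨y, by rwa [dist_comm], by rwa [Metric.infDist_zero_of_mem hy]⟩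
    exact ⟨n, hn⟩
  have hAm : ∀ n, MeasurableSet {p | A p n} := fun n =>
    (measurableSet_lt (measurable_const.dist hh)
      ((hX.measurable_infDist hh).add_const δ)).inter
      (measurableSet_lt (hX.measurable_infDist measurable_const) measurable_const)
  refine ⟨fun p => c (Nat.find (hA p)), ?_, fun p => (Nat.find_spec (hA p)).1,
    fun p => (Nat.find_spec (hA p)).2⟩
  exact (measurable_from_nat (f := c)).comp (measurable_find hA hAm)

variable [CompleteSpace E]

/-- A Kuratowski–Ryll-Nardzewski selection that nearly realises the distance to `h`. -/
theorem IsRandomClosedSet.exists_measurable_selection (hX : IsRandomClosedSet mα X) {h : α → E}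
    (hh : Measurable h) {ε : ℝ} (hε : 0 < ε) :
    ∃ f : α → E, Measurable f ∧ (∀ p, f p ∈ X p) ∧
      ∀ p, dist (f p) (h p) ≤ Metric.infDist (h p) (X p) + ε := by
  -- Successive approximations differ by less than δ n + δ (n + 1) ≤ 2 δ n, which sums to ε / 2;
  -- with the initial error δ 0 = ε / 8 the total stays below ε.
  let δ : ℕ → ℝ := fun n => ε / 8 * (1 / 2) ^ n
  have hδ : ∀ n, 0 < δ n := fun n => by positivity
  choose! F hFm hFd hFi using fun (n : ℕ) (g : α → E) (hg : Measurable g) =>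
    hX.exists_measurable_approx hg (hδ n)
  let u : ℕ → α → E := fun n => Nat.rec (F 0 h) (fun n g => F (n + 1) g) n
  have hum : ∀ n, Measurable (u n) := by
    intro n
    induction n with
    | zero => exact hFm 0 h hh
    | succ n ih => exact hFm (n + 1) _ ih
  have hui : ∀ n p, Metric.infDist (u n p) (X p) < δ n := by
    intro n p
    cases n with
    | zero => exact hFi 0 h hh p
    | succ n => exact hFi (n + 1) _ (hum n) p
  have hud : ∀ p n, dist (u n p) (u (n + 1) p) ≤ ε / 4 * (1 / 2) ^ n := by
    intro p n
    have h1 := hFd (n + 1) _ (hum n) p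
    have h2 := hui n p
    rw [dist_comm]
    have h3 : δ (n + 1) ≤ δ n := by
      simp only [δ, pow_succ]
      have : 0 < ε / 8 * (1 / 2 : ℝ) ^ n := by positivity
      linarith
    have h4 : ε / 4 * (1 / 2 : ℝ) ^ n = δ n + δ n := by simp only [δ]; ring
    change dist (F (n + 1) (u n) p) (u n p) ≤ _
    linarith
  have hcau : ∀ p, ∃ y, Tendsto (fun n => u n p) atTop (𝓝 y) := fun p =>
    cauchySeq_tendsto_of_complete (cauchySeq_of_le_geometric _ _ (by norm_num) (hud p))
  choose f hf using hcau
  refine ⟨f, measurable_of_tendsto_metrizable hum (tendsto_pi_nhds.2 hf), fun p => ?_,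
    fun p => ?_⟩
  · rw [(hX.closed p).mem_iff_infDist_zero (hX.nonempty p)]
    have hδ0 : Tendsto δ atTop (𝓝 0) := by
      simpa [δ] using (tendsto_pow_atTop_nhds_zero_of_lt_one (r := (1 / 2 : ℝ)) (by norm_num)
        (by norm_num)).const_mul (ε / 8)
    exact le_antisymm (le_of_tendsto_of_tendsto'
      (((Metric.continuous_infDist_pt (X p)).tendsto _).comp (hf p)) hδ0
      fun n => (hui n p).le) Metric.infDist_nonneg
  · have h1 := dist_le_of_le_geometric_of_tendsto₀ _ _ (by norm_num) (hud p) (hf p)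
    have h2 := hFd 0 h hh p
    have h3 : δ 0 = ε / 8 := by simp [δ]
    have h4 := dist_triangle_left (f p) (h p) (u 0 p)
    change dist (u 0 p) (h p) < _ at h2
    norm_num at h1
    linarith

/-- A Castaing representation. -/
theorem IsRandomClosedSet.exists_dense_selections (hX : IsRandomClosedSet mα X) :
    ∃ b : ℕ × ℕ → α → E, (∀ i, Measurable (b i)) ∧ (∀ i p, b i p ∈ X p) ∧
      ∀ p, X p ⊆ closure (Set.range fun i => b i p) := by
  rcases isEmpty_or_nonempty E with hE | hE
  · have hα : IsEmpty α := ⟨fun p => hE.elim (hX.nonempty p).some⟩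
    exact ⟨fun _ p => hα.elim p, fun _ => measurable_of_empty _, fun _ p => hα.elim p,
      fun p => hα.elim p⟩
  choose b hbm hbX hbd using fun i : ℕ × ℕ => hX.exists_measurable_selection
    (measurable_const (a := TopologicalSpace.denseSeq E i.1))
    (Nat.one_div_pos_of_nat (n := i.2) (α := ℝ))
  refine ⟨b, hbm, hbX, fun p x hx => Metric.mem_closure_range_iff.2 fun ε hε => ?_⟩
  obtain ⟨k, hk⟩ := (TopologicalSpace.denseRange_denseSeq E).exists_dist_lt x
    (show 0 < ε / 4 by positivity)
  obtain ⟨n, hn⟩ := exists_nat_one_div_lt (show 0 < ε / 4 by positivity)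
  refine ⟨(k, n), ?_⟩
  have h1 := hbd (k, n) p
  have h2 := Metric.infDist_le_dist_of_mem (x := TopologicalSpace.denseSeq E k) hx
  have h3 := dist_triangle_right x (b (k, n) p) (TopologicalSpace.denseSeq E k)
  have h4 := dist_comm x (TopologicalSpace.denseSeq E k)
  dsimp only at h1
  linarith

end Selections

/-! ### Separability of E from that of its dual. -/

section Separability

/-- A normed space with separable dual is separable. -/
theorem separableSpace_of_separableSpace_dual (E : Type*) [NormedAddCommGroup E]
    [NormedSpace ℝ E] [TopologicalSpace.SeparableSpace (StrongDual ℝ E)] :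
    TopologicalSpace.SeparableSpace E := by
  let c := TopologicalSpace.denseSeq (StrongDual ℝ E)
  have hx : ∀ n, ∃ x : E, ‖x‖ ≤ 1 ∧ ‖c n‖ / 2 ≤ ‖c n x‖ := by
    intro n
    rcases (norm_nonneg (c n)).eq_or_lt with h | h
    · exact ⟨0, by simp, by simp [← h]⟩
    · obtain ⟨x, hx1, hx2⟩ := (c n).exists_lt_apply_of_lt_opNorm (half_lt_self h)
      exact ⟨x, hx1.le, hx2.le⟩
  choose x hx1 hx2 using hx
  have hsep : TopologicalSpace.IsSeparable (Submodule.span ℝ (Set.range x) : Set E) :=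
    (Set.countable_range x).isSeparable.span
  have htop : (Submodule.span ℝ (Set.range x)).topologicalClosure = ⊤ := by
    by_contra hne
    obtain ⟨z, hz⟩ : ∃ z, z ∉ (Submodule.span ℝ (Set.range x)).topologicalClosure := by
      by_contra! hall
      exact hne (Submodule.eq_top_iff'.2 hall)
    obtain ⟨f, hf0, hf⟩ : ∃ f : StrongDual ℝ E, f ≠ 0 ∧ ∀ n, f (x n) = 0 := by
      obtain ⟨f, a, hfa, haz⟩ := geometric_hahn_banach_closed_point
        (Submodule.span ℝ (Set.range x)).topologicalClosure.convex
        (Submodule.isClosed_topologicalClosure _) hz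
      have ha : 0 < a := by simpa using hfa 0 (Submodule.zero_mem _)
      refine ⟨f, fun h => ?_, fun n => ?_⟩
      · rw [h] at haz
        exact lt_asymm ha haz
      -- Otherwise a multiple of x n in the subspace takes the value a, against the strict bound.
      · by_contra hne
        have hmem : (a / f (x n)) • x n ∈
            (Submodule.span ℝ (Set.range x)).topologicalClosure :=
          Submodule.smul_mem _ _ (Submodule.le_topologicalClosure _
            (Submodule.subset_span ⟨n, rfl⟩))
        have := hfa _ hmem
        rw [map_smul, smul_eq_mul, div_mul_cancel₀ _ hne] at this
        exact lt_irrefl _ this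
    -- As f kills x n, ‖c n‖ / 2 ≤ ‖c n - f‖ < ‖f‖ / 4, whereas ‖c n‖ > 3‖f‖ / 4.
    obtain ⟨n, hn⟩ := (TopologicalSpace.denseRange_denseSeq (StrongDual ℝ E)).exists_dist_lt f
      (show 0 < ‖f‖ / 4 by positivity)
    rw [dist_eq_norm, norm_sub_rev] at hn
    have h1 : ‖c n (x n)‖ ≤ ‖c n - f‖ := by
      have := (c n - f).le_opNorm_of_le (hx1 n)
      simpa [hf n] using this
    have h2 := hx2 n
    have h3 := norm_sub_norm_le f (c n)
    rw [norm_sub_rev] at h3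
    change ‖c n - f‖ < _ at hn
    linarith [norm_nonneg f]
  have huniv : TopologicalSpace.IsSeparable (Set.univ : Set E) := by
    have := hsep.closure
    rwa [← Submodule.topologicalClosure_coe, htop] at this
  exact TopologicalSpace.isSeparable_univ_iff.1 huniv

end Separability

lemma IsNucleationProcess.monotone {t₀ T : ℝ} {Ω E : Type*} {m : MeasurableSpace Ω}
    [TopologicalSpace E] {𝓕 : Filtration (Set.Icc t₀ T) m} {B : Set.Icc t₀ T → Ω → Set E}
    (hB : IsNucleationProcess 𝓕 B) (ω : Ω) :
    Monotone fun t => B t ω :=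
  monotone_iff_forall_lt.2 fun s t hst => hB.increasing s t hst ω

/-! ### Adaptedness of Aumann integrals and of nucleus-plus-growth sets. -/

section Adaptedness

variable {t₀ T : ℝ} [Fact (t₀ ≤ T)] {Ω E : Type*} {m : MeasurableSpace Ω}
  {𝓕 : Filtration (Set.Icc t₀ T) m}

lemma measurable_fst_predictable : Measurable[𝓕.predictable] (Prod.fst : Set.Icc t₀ T × Ω → _) := by
  refine measurable_of_Ioi fun a => ?_
  have h := measurableSet_predictable_Ioi_prod (𝓕 := 𝓕) (i := a) MeasurableSet.univ
  rwa [Set.prod_univ] at h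

/-- Stopping time at `t` maps the product `σ`-algebra with `𝓕 t` to the predictable one. -/
lemma measurable_min_predictable (t : Set.Icc t₀ T) :
    @Measurable (Set.Icc t₀ T × Ω) (Set.Icc t₀ T × Ω)
      (@Prod.instMeasurableSpace _ _ _ (𝓕 t)) 𝓕.predictable fun p => (min p.1 t, p.2) := by
  let _ : MeasurableSpace Ω := 𝓕 t
  have h : Measurable fun p : Set.Icc t₀ T × Ω =>
      ((⟨min p.1 t, Set.mem_Iic.2 (min_le_right _ _)⟩ : Set.Iic t), p.2) :=
    ((measurable_fst.min measurable_const).subtype_mk).prodMk measurable_snd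
  exact @Measurable.comp _ _ _ _ _ 𝓕.predictable _ _
    (measurable_inclusion_predictable (𝓕 := 𝓕) (i := t)) h

lemma measurable_prodMk_predictable (ω : Ω) :
    Measurable[_, 𝓕.predictable] fun τ : Set.Icc t₀ T => (τ, ω) := by
  let _ : MeasurableSpace Ω := 𝓕 ⊤
  have h := @Measurable.comp _ _ _ _ _ 𝓕.predictable _ _
    (measurable_min_predictable (𝓕 := 𝓕) (⊤ : Set.Icc t₀ T))
    (measurable_prodMk_right (α := Set.Icc t₀ T) (y := ω))
  simpa [Function.comp_def] using h

variable [NormedAddCommGroup E] [NormedSpace ℝ E] {B G : Set.Icc t₀ T → Ω → Set E}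

lemma IsGrowthProcess.isRandomClosedSet (hG : IsGrowthProcess 𝓕 G) :
    IsRandomClosedSet 𝓕.predictable fun p : Set.Icc t₀ T × Ω => G p.1 p.2 :=
  ⟨fun p => ⟨0, hG.zero_mem p.1 p.2⟩, fun p => hG.closed p.1 p.2, hG.predictable⟩

lemma IsGrowthProcess.exists_bound (hG : IsGrowthProcess 𝓕 G) :
    ∃ M : ℝ, 0 ≤ M ∧ ∀ t ω, ∀ y ∈ G t ω, ‖y‖ ≤ M := by
  obtain ⟨K, -, -, hK, hGK⟩ := hG.bounded
  obtain ⟨M, hM0, hM⟩ := hK.exists_pos_norm_le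
  exact ⟨M, hM0.le, fun t ω y hy => hM y (hGK t ω hy)⟩

variable [TopologicalSpace.SeparableSpace E] [MeasurableSpace E] [BorelSpace E]

/-- Time integrals of predictable processes are adapted. -/
lemma measurable_setIntegral_of_predictable {p : Set.Icc t₀ T × Ω → E}
    (hp : Measurable[𝓕.predictable] p) (r t : Set.Icc t₀ T) :
    Measurable[𝓕 t] fun ω => ∫ τ in Set.Icc r t, p (τ, ω) ∂(Measure.comap Subtype.val volume) := by
  let _ : MeasurableSpace Ω := 𝓕 t
  have := UniformSpace.secondCountable_of_separable E
  -- The stopped integrand agrees with p on [r, t] and is measurable for Borel ⊗ `𝓕 t`, so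
  -- parametric integration stays within `𝓕 t`.
  have h : Measurable fun q : Set.Icc t₀ T × Ω => p (min q.1 t, q.2) :=
    @Measurable.comp _ _ _ _ 𝓕.predictable _ _ _ hp (measurable_min_predictable (𝓕 := 𝓕) t)
  have h' := (h.stronglyMeasurable.integral_prod_left'
    (μ := (Measure.comap (Subtype.val : Set.Icc t₀ T → ℝ) volume).restrict (Set.Icc r t))).measurable
  convert h' using 2 with ω
  refine setIntegral_congr_fun measurableSet_Icc fun τ hτ => ?_
  simp only [min_eq_left hτ.2]

variable [CompleteSpace E]

/-- The Aumann integral of a growth process has a Castaing representation. -/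
theorem IsGrowthProcess.exists_dense_growthIntegral (hG : IsGrowthProcess 𝓕 G)
    (r t : Set.Icc t₀ T) :
    ∃ y : ℕ × ℕ → Ω → E, (∀ i, Measurable[𝓕 t] (y i)) ∧
      (∀ i ω, y i ω ∈ growthIntegral G r t ω) ∧
      ∀ ω, growthIntegral G r t ω ⊆ closure (Set.range fun i => y i ω) := by
  have := UniformSpace.secondCountable_of_separable E
  obtain ⟨M, hM0, hM⟩ := hG.exists_bound
  set μ := Measure.comap (Subtype.val : Set.Icc t₀ T → ℝ) volume with hμ
  have : Fact ((1 : ℝ≥0∞) ≠ ∞) := ⟨ENNReal.one_ne_top⟩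
  -- Deterministic targets: the selections of G nearly closest to the c k are predictable, and for
  -- each ω they approximate any integrable selection in L¹.
  let c := TopologicalSpace.denseSeq (Lp E 1 μ)
  have hc : ∀ k, Measurable[𝓕.predictable] fun q : Set.Icc t₀ T × Ω => c k q.1 := fun k =>
    @Measurable.comp _ _ _ 𝓕.predictable _ _ _ _ (Lp.stronglyMeasurable (c k)).measurable
      measurable_fst_predictable
  choose p hpm hpG hpd using fun i : ℕ × ℕ => hG.isRandomClosedSet.exists_measurable_selection
    (hc i.1) (Nat.one_div_pos_of_nat (n := i.2) (α := ℝ))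
  have hpi : ∀ i ω, Integrable (fun τ => p i (τ, ω)) μ := by
    intro i ω
    have hmeas : Measurable fun τ => p i (τ, ω) :=
      @Measurable.comp _ _ _ _ 𝓕.predictable _ _ _ (hpm i) (measurable_prodMk_predictable ω)
    exact Integrable.of_bound hmeas.aestronglyMeasurable M
      (ae_of_all _ fun τ => hM τ ω _ (hpG i (τ, ω)))
  refine ⟨fun i ω => ∫ τ in Set.Icc r t, p i (τ, ω) ∂μ,
    fun i => measurable_setIntegral_of_predictable (hpm i) r t,
    fun i ω => ⟨_, ⟨hpi i ω, ae_of_all _ fun τ => hpG i (τ, ω)⟩, rfl⟩, ?_⟩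
  rintro ω _ ⟨g, ⟨hg, hgG⟩, rfl⟩
  refine Metric.mem_closure_range_iff.2 fun ε hε => ?_
  obtain ⟨k, hk⟩ := (TopologicalSpace.denseRange_denseSeq (Lp E 1 μ)).exists_dist_lt
    (hg.toL1 g) (show 0 < ε / 4 by positivity)
  obtain ⟨n, hn⟩ := exists_nat_one_div_lt
    (show 0 < ε / (4 * (μ.real Set.univ + 1)) by positivity)
  refine ⟨(k, n), ?_⟩
  have hck : Integrable (fun τ => ‖c k τ - g τ‖) μ := ((L1.integrable_coeFn (c k)).sub hg).norm
  have hnorm : ∫ τ, ‖c k τ - g τ‖ ∂μ < ε / 4 := by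
    rw [dist_comm, dist_eq_norm, L1.norm_eq_integral_norm] at hk
    refine (integral_congr_ae ?_).trans_lt hk
    filter_upwards [Lp.coeFn_sub (c k) (hg.toL1 g), hg.coeFn_toL1] with τ h1 h2
    change _ = ‖(c k - hg.toL1 g) τ‖
    rw [h1, Pi.sub_apply, h2]
  -- Since g τ lies in G, c k τ is no farther from G than from g τ; the triangle inequality then
  -- supplies the factor 2.
  have hpt : ∀ᵐ τ ∂μ, ‖g τ - p (k, n) (τ, ω)‖ ≤ 2 * ‖c k τ - g τ‖ + 1 / ((n : ℝ) + 1) := by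
    filter_upwards [hgG] with τ hτ
    have h1 := hpd (k, n) (τ, ω)
    have h2 := Metric.infDist_le_dist_of_mem (x := c k τ) hτ
    have h3 := dist_triangle (g τ) (c k τ) (p (k, n) (τ, ω))
    rw [dist_comm (g τ) (c k τ), dist_comm (c k τ) (p (k, n) (τ, ω))] at h3
    rw [← dist_eq_norm, ← dist_eq_norm]
    dsimp only at h1 h2
    linarith
  rw [dist_eq_norm, ← integral_sub hg.integrableOn (hpi (k, n) ω).integrableOn]
  calc ‖∫ τ in Set.Icc r t, g τ - p (k, n) (τ, ω) ∂μ‖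
      ≤ ∫ τ in Set.Icc r t, ‖g τ - p (k, n) (τ, ω)‖ ∂μ := norm_integral_le_integral_norm _
    _ ≤ ∫ τ, ‖g τ - p (k, n) (τ, ω)‖ ∂μ :=
        setIntegral_le_integral (hg.sub (hpi (k, n) ω)).norm (ae_of_all _ fun _ => norm_nonneg _)
    _ ≤ ∫ τ, (2 * ‖c k τ - g τ‖ + 1 / ((n : ℝ) + 1)) ∂μ :=
        integral_mono_ae (hg.sub (hpi (k, n) ω)).norm
          ((hck.const_mul 2).add (integrable_const _)) hpt
    _ = 2 * ∫ τ, ‖c k τ - g τ‖ ∂μ + μ.real Set.univ * (1 / ((n : ℝ) + 1)) := by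
        rw [integral_add (hck.const_mul 2) (integrable_const _), integral_const_mul,
          integral_const, smul_eq_mul]
    _ < ε := by
        have h1 : 0 ≤ μ.real Set.univ := measureReal_nonneg
        have h2 : μ.real Set.univ * (1 / ((n : ℝ) + 1)) ≤ ε / 4 := by
          calc μ.real Set.univ * (1 / ((n : ℝ) + 1))
              ≤ (μ.real Set.univ + 1) * (ε / (4 * (μ.real Set.univ + 1))) := by
                gcongr
                linarith
            _ = ε / 4 := by field_simp
        linarith

/-- Sums of the two Castaing families are dense in the Minkowski sum, so hitting an open set is a
countable union of events. -/
lemma setMeasurable_add_growthIntegral (hB : IsNucleationProcess 𝓕 B)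
    (hG : IsGrowthProcess 𝓕 G) {r t : Set.Icc t₀ T} (hrt : r ≤ t) :
    SetMeasurable (𝓕 t) fun ω => B r ω + growthIntegral G r t ω := by
  intro O hO
  have := UniformSpace.secondCountable_of_separable E
  obtain ⟨b, hbm, hbB, hbd⟩ := (hB.adapted r).exists_dense_selections
  obtain ⟨y, hym, hyI, hyd⟩ := hG.exists_dense_growthIntegral r t
  have hset : {ω | ((B r ω + growthIntegral G r t ω) ∩ O).Nonempty} =
      ⋃ (i) (j), (fun ω => b i ω + y j ω) ⁻¹' O := by
    ext ω
    simp only [Set.mem_iUnion, Set.mem_preimage]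
    constructor
    · rintro ⟨_, ⟨x, hx, z, hz, rfl⟩, hxz⟩
      have hmem : (x, z) ∈ closure (Set.range (fun i => b i ω) ×ˢ Set.range fun j => y j ω) := by
        rw [closure_prod_eq]
        exact ⟨hbd ω hx, hyd ω hz⟩
      obtain ⟨⟨_, _⟩, hO', ⟨i, rfl⟩, ⟨j, rfl⟩⟩ :=
        mem_closure_iff.1 hmem _ (hO.preimage continuous_add) hxz
      exact ⟨i, j, hO'⟩
    · rintro ⟨i, j, hij⟩
      exact ⟨_, Set.add_mem_add (hbB i ω) (hyI j ω), hij⟩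
  rw [hset]
  refine MeasurableSet.iUnion fun i => MeasurableSet.iUnion fun j => ?_
  have hbt : Measurable[𝓕 t] (b i) := (hbm i).mono (𝓕.mono hrt) le_rfl
  let _ : MeasurableSpace Ω := 𝓕 t
  exact (hbt.add (hym j)) hO.measurableSet

end Adaptedness

lemma SetMeasurable.closure_iUnion {Ω E ι : Type*} [Countable ι] [TopologicalSpace E]
    {m : MeasurableSpace Ω} {X : ι → Ω → Set E} (hX : ∀ i, SetMeasurable m (X i)) :
    SetMeasurable m fun ω => closure (⋃ i, X i ω) := by
  intro O hO
  have hset : {ω | (closure (⋃ i, X i ω) ∩ O).Nonempty} = ⋃ i, {ω | (X i ω ∩ O).Nonempty} := by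
    ext ω
    simp only [closure_inter_open_nonempty_iff hO, Set.iUnion_inter, Set.nonempty_iUnion,
      Set.mem_iUnion, Set.mem_ofPred_eq]
  rw [hset]
  exact MeasurableSet.iUnion fun i => hX i O hO

/-- The hitting events differ only inside a null set, all of whose subsets belong to m. -/
lemma SetMeasurable.congr_ae {Ω E : Type*} [TopologicalSpace E] {m m' : MeasurableSpace Ω}
    {P : Measure[m'] Ω} (hm : ∀ A, P A = 0 → MeasurableSet[m] A) {X Y : Ω → Set E}
    (hX : SetMeasurable m X) (hXY : ∀ᵐ ω ∂P, X ω = Y ω) : SetMeasurable m Y := by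
  intro O hO
  have hN : ∀ A ⊆ {ω | ¬ X ω = Y ω}, MeasurableSet[m] A := fun A hA =>
    hm A (measure_mono_null hA (ae_iff.1 hXY))
  have hset : {ω | (Y ω ∩ O).Nonempty} =
      ({ω | (X ω ∩ O).Nonempty} \ {ω | ¬ X ω = Y ω}) ∪
        ({ω | (Y ω ∩ O).Nonempty} ∩ {ω | ¬ X ω = Y ω}) := by
    ext ω
    by_cases h : X ω = Y ω <;> simp [h]
  rw [hset]
  exact ((hX O hO).diff (hN _ subset_rfl)).union (hN _ Set.inter_subset_right)

end BirthGrowth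

theorem mainTheorem1 {E : Type*} [NormedAddCommGroup E] [NormedSpace ℝ E] [CompleteSpace E]
    (hrefl : BirthGrowth.IsReflexiveSpace E)
    [TopologicalSpace.SeparableSpace (StrongDual ℝ E)]
    {t₀ T : ℝ} [Fact (t₀ ≤ T)]
    {Ω : Type*} {m : MeasurableSpace Ω} (P : MeasureTheory.Measure Ω)
    [MeasureTheory.IsProbabilityMeasure P]
    (𝓕 : MeasureTheory.Filtration (Set.Icc t₀ T) m) (h𝓕 : BirthGrowth.UsualConditions 𝓕 P)
    (B G : Set.Icc t₀ T → Ω → Set E)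
    (hB : BirthGrowth.IsNucleationProcess 𝓕 B) (hG : BirthGrowth.IsGrowthProcess 𝓕 G)
    (Q : ∀ t : Set.Icc t₀ T, ℕ → BirthGrowth.TimePartition t)
    (hQ : ∀ t, BirthGrowth.IsRefinementSequence (Q t)) :
    (∃ Θ : Set.Icc t₀ T → Ω → Set E, BirthGrowth.IsGeometricRandomProcess P B G Q Θ) ∧
    ∀ Θ : Set.Icc t₀ T → Ω → Set E, BirthGrowth.IsGeometricRandomProcess P B G Q Θ →
      (∀ᵐ ω ∂P, ∀ s t, s < t → Θ s ω ⊆ Θ t ω) ∧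
      (∀ t, BirthGrowth.IsRandomClosedSet (𝓕 t) (Θ t)) := by
  have hsep := BirthGrowth.separableSpace_of_separableSpace_dual E
  borelize E
  obtain ⟨M, hM0, hM⟩ := hG.exists_bound
  refine ⟨⟨fun t ω => closure (⋃ j, BirthGrowth.lowerSum B G (Q t j) ω), ?_, ?_, ?_⟩, ?_⟩
  · intro t ω
    obtain ⟨b, hb⟩ := (hB.adapted ⊥).nonempty ω
    refine ⟨b + 0, subset_closure (Set.mem_iUnion.2 ⟨0, Or.inl (subset_closure ?_)⟩)⟩
    exact Set.add_mem_add hb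
      (BirthGrowth.zero_mem_growthIntegral (fun τ => hG.zero_mem τ ω) _ _)
  · exact fun t ω => isClosed_closure
  · exact Eventually.of_forall fun ω t => BirthGrowth.isCommonLimit_closure_iUnion_lowerSum
      (hB.monotone ω) (fun τ => hG.zero_mem τ ω) hM0 (fun τ => hM τ ω) (hQ t)
  · intro Θ hΘ
    refine ⟨?_, fun t => ⟨hΘ.nonempty t, hΘ.closed t, ?_⟩⟩
    · filter_upwards [hΘ.limit] with ω hω s t hst
      -- Lower sums describe the earlier set and upper sums the later one; a single null set serves
      -- all pairs s < t.
      rw [(hω s).closure_iUnion_lower, (hω t).iInter_upper]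
      exact Set.subset_iInter fun j =>
        BirthGrowth.closure_iUnion_lowerSum_subset_upperSum (hB.monotone ω)
          (fun τ => hG.zero_mem τ ω) hst.le (Q s) (Q t j)
    · refine BirthGrowth.SetMeasurable.congr_ae (h𝓕.complete t)
        (BirthGrowth.SetMeasurable.closure_iUnion fun q : Σ j, Fin ((Q t j).n + 1) =>
          BirthGrowth.setMeasurable_add_growthIntegral hB hG ((Q t q.1).pts_le q.2)) ?_
      filter_upwards [hΘ.limit] with ω hω
      rw [(hω t).closure_iUnion_lower, BirthGrowth.closure_iUnion_lowerSum_eq (hB.monotone ω)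
        (fun τ => hG.zero_mem τ ω)
        ((hω t).closure_iUnion_lower.symm.trans (hω t).iInter_upper), Set.iUnion_sigma]
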